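/- For every collision rate $\nu>0$ there is $\varepsilon>0$, depending only on $\nu$, with the following property. Let $n\in\{2,3,\dots\}\cup\{\infty\}$ and let $P_0,E_0\in C^n(\mathbb R)$ satisfy $$E_0(\rho)^2+P_0(\rho)^2+E_0'(\rho)^2+P_0'(\rho)^2\le\varepsilon^2\qquad\text{for all }\rho\in\mathbb R .$$ Then the Cauchy problem for plane one-dimensional relativistic cold-plasma oscillations with collisions, $$\frac{\partial P}{\partial\theta}+V\frac{\partial P}{\partial\rho}+E+\nu P=0,\qquad \frac{\partial E}{\partial\theta}+V\frac{\partial E}{\partial\rho}-V=0,\qquad V=\frac{P}{\sqrt{1+P^2}},$$ for $\rho\in\mathbb R$, $\theta>0$, with $P(\rho,0)=P_0(\rho)$, $E(\rho,0)=E_0(\rho)$, has a classical solution $(P,E)$ that remains smooth for all $\theta>0$, that is, $P,E\in C^n(\mathbb R\times[0,\infty))$. It is the solution of the problem: every $C^1$ solution with the same initial data on a time interval $[0,T)$ coincides with $(P,E)$ on $\mathbb R\times[0,T)$. -/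

import Mathlib

open Set

noncomputable section

namespace ColdPlasma

/-- The dimensionless electron velocity `V = P / √(1 + P²)` as a function of the momentum `P`. -/
def velocity (p : ℝ) : ℝ := p / Real.sqrt (1 + p ^ 2)

/-- `(P, E)` is a classical solution of class `Cⁿ` of the Cauchy problem for plane
one-dimensional relativistic plasma oscillations with collision rate `ν`,

  `∂P/∂θ + V ∂P/∂ρ + E + ν P = 0`,  `∂E/∂θ + V ∂E/∂ρ - V = 0`,  `V = P / √(1 + P²)`,
  `P(ρ, 0) = P₀(ρ)`,  `E(ρ, 0) = E₀(ρ)`,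

for `ρ ∈ ℝ` and `θ` in the time interval `I`, which is meant to be `[0, T)` or `[0, ∞)`.
The arguments of `P` and `E` are `ρ` (space) and `θ` (time), in this order. The functions are
jointly `Cⁿ` up to the initial line `θ = 0`; the equations are imposed for `θ > 0`. Values at
times outside `I` play no role. -/
structure IsClassicalSolution (ν : ℝ) (n : ℕ∞) (I : Set ℝ) (P₀ E₀ : ℝ → ℝ)
    (P E : ℝ → ℝ → ℝ) : Prop where
  contDiffOn_P : ContDiffOn ℝ n (fun x : ℝ × ℝ => P x.1 x.2) (univ ×ˢ I)
  contDiffOn_E : ContDiffOn ℝ n (fun x : ℝ × ℝ => E x.1 x.2) (univ ×ˢ I)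
  eq_P : ∀ ρ : ℝ, ∀ θ ∈ I, 0 < θ →
    deriv (fun t => P ρ t) θ + velocity (P ρ θ) * deriv (fun r => P r θ) ρ
      + E ρ θ + ν * P ρ θ = 0
  eq_E : ∀ ρ : ℝ, ∀ θ ∈ I, 0 < θ →
    deriv (fun t => E ρ t) θ + velocity (P ρ θ) * deriv (fun r => E r θ) ρ
      - velocity (P ρ θ) = 0
  init_P : ∀ ρ : ℝ, P ρ 0 = P₀ ρ
  init_E : ∀ ρ : ℝ, E ρ 0 = E₀ ρ

end ColdPlasma

end

/-! Along a characteristic `x' = V`, the system becomes `p' = -e - νp`, `e' = V(p)`, a globally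
Lipschitz ODE for each starting point `r`. It has global solutions, jointly `Cⁿ` in `(r, t)`
(`contDiff_solution`). Since `x' = e'`, the position is `x = r + e - E₀(r)`, so smoothness can fail
only if `∂x/∂r = 1 + b - E₀'(r)` vanishes, where `(a, b)` solves the linearized system `a' = -b -
νa`, `b' = m a` with `m = (1 + p²)^(-3/2)`.

Smallness rules this out. The energy `√(1 + p²) + e²/2` does not increase, so `m` stays close to
`1`. Friction damps only `a`; adding a small multiple of `ab` to `a² + b²` also gives decay in `b`,
enough to absorb the error `m - 1` (`linearized_le`). Hence `b` stays small and `∂x/∂r > 0` for all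
`t ≥ 0`. As `|x - r|` is bounded, `r ↦ x` is a bijection of the line. The inverse function theorem
makes its inverse `Cⁿ`, which gives the Eulerian solution (`isClassicalSolution`).

For uniqueness, a competing solution is compared with `(p, e)` along these same characteristics by
Gronwall (`eq_of_isClassicalSolution`). -/

namespace ColdPlasma

open Filter Topology
open scoped NNReal

/-! ### Lipschitz ODEs: stability and global existence. -/

section ODE

variable {E : Type*} [NormedAddCommGroup E] [NormedSpace ℝ E]

theorem gronwallBound_le {δ K ε x : ℝ} (hε : 0 ≤ ε) (hK : 0 ≤ K) :
    gronwallBound δ K ε x ≤ (δ + ε * x) * Real.exp (K * x) := by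
  rcases hK.eq_or_lt with rfl | hK
  · simp [gronwallBound_K0]
  · rw [gronwallBound_of_K_ne_0 hK.ne']
    have h1 := Real.add_one_le_exp (-(K * x))
    have h2 : Real.exp (K * x) * Real.exp (-(K * x)) = 1 := by
      rw [← Real.exp_add]; simp
    have h3 := Real.exp_pos (K * x)
    have h4 : Real.exp (K * x) - 1 ≤ K * x * Real.exp (K * x) := by nlinarith
    have h5 : ε / K * (Real.exp (K * x) - 1) ≤ ε / K * (K * x * Real.exp (K * x)) := by gcongr
    have h6 : ε / K * (K * x * Real.exp (K * x)) = ε * x * Real.exp (K * x) := by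
      field_simp
    linarith

/-- Distance of an exact solution to an approximate one, forward in time. -/
theorem norm_sub_le_of_approx_forward {f : ℝ → E → E} {K : ℝ≥0} (hf : ∀ t, LipschitzWith K (f t))
    {u g g' : ℝ → E} (hu : ∀ t, HasDerivAt u (f t (u t)) t) (hg : ∀ t, HasDerivAt g (g' t) t)
    {T δ ε : ℝ} (hT : 0 ≤ T) (hε : 0 ≤ ε) (h0 : ‖u 0 - g 0‖ ≤ δ)
    (hb : ∀ t ∈ Icc 0 T, ‖g' t - f t (g t)‖ ≤ ε) :
    ‖u T - g T‖ ≤ (δ + ε * T) * Real.exp (K * T) := by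
  have := dist_le_of_approx_trajectories_ODE (v := f) (K := K) (f := u) (g := g) (a := 0) (b := T)
    (εf := 0) (εg := ε) (δ := δ) hf (fun t _ => (hu t).continuousAt.continuousWithinAt)
    (fun t _ => (hu t).hasDerivWithinAt) (by simp)
    (fun t _ => (hg t).continuousAt.continuousWithinAt)
    (fun t _ => (hg t).hasDerivWithinAt)
    (fun t ht => by rw [dist_eq_norm]; exact hb t ⟨ht.1, ht.2.le⟩)
    (by rwa [dist_eq_norm]) T ⟨hT, le_rfl⟩
  rw [dist_eq_norm, zero_add, sub_zero] at this
  exact this.trans (gronwallBound_le hε K.2)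

/-- Distance of an exact solution to an approximate one, in both time directions. -/
theorem norm_sub_le_of_approx {f : ℝ → E → E} {K : ℝ≥0} (hf : ∀ t, LipschitzWith K (f t))
    {u g g' : ℝ → E} (hu : ∀ t, HasDerivAt u (f t (u t)) t) (hg : ∀ t, HasDerivAt g (g' t) t)
    {T δ ε : ℝ} (hε : 0 ≤ ε) (h0 : ‖u 0 - g 0‖ ≤ δ)
    (hb : ∀ t ∈ Icc (-T) T, ‖g' t - f t (g t)‖ ≤ ε) :
    ∀ t ∈ Icc (-T) T, ‖u t - g t‖ ≤ (δ + ε * T) * Real.exp (K * T) := by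
  intro t ht
  have hδ : 0 ≤ δ := (norm_nonneg _).trans h0
  have key : ∀ s, 0 ≤ s → s ≤ T →
      (δ + ε * s) * Real.exp (K * s) ≤ (δ + ε * T) * Real.exp (K * T) := by
    intro s hs hsT
    have hT := hs.trans hsT
    gcongr
  rcases le_total 0 t with h | h
  · exact (norm_sub_le_of_approx_forward hf hu hg h hε h0
      (fun s hs => hb s ⟨by linarith [hs.1, ht.2], hs.2.trans ht.2⟩)).trans (key _ h ht.2)
  -- Negative times reduce to the forward estimate by time reversal.
  · have := norm_sub_le_of_approx_forward (f := fun t x => -f (-t) x) (K := K)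
      (u := fun t => u (-t)) (g := fun t => g (-t)) (g' := fun t => -g' (-t)) (T := -t)
      (fun t => (hf (-t)).neg)
      (fun t => by simpa [Function.comp_def] using (hu (-t)).scomp t (hasDerivAt_neg t))
      (fun t => by simpa [Function.comp_def] using (hg (-t)).scomp t (hasDerivAt_neg t))
      (by linarith) hε (by simpa using h0)
      (fun s hs => by
        rw [← neg_sub', norm_neg]
        exact hb (-s) ⟨by linarith [hs.2, ht.1], by linarith [hs.1, ht.1]⟩)
    simp only [neg_neg] at this
    exact this.trans (key (-t) (by linarith) (by linarith [ht.1]))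

theorem abs_integral_exp_abs_le {Λ : ℝ} (hΛ : 0 < Λ) (t : ℝ) :
    |∫ s in (0 : ℝ)..t, Real.exp (Λ * |s|)| ≤ Real.exp (Λ * |t|) / Λ := by
  have key : ∀ t : ℝ, 0 ≤ t →
      |∫ s in (0 : ℝ)..t, Real.exp (Λ * |s|)| ≤ Real.exp (Λ * |t|) / Λ := by
    intro t ht
    have h1 : ∫ s in (0 : ℝ)..t, Real.exp (Λ * |s|) = ∫ s in (0 : ℝ)..t, Real.exp (Λ * s) := by
      apply intervalIntegral.integral_congr
      intro s hs
      rw [uIcc_of_le ht] at hs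
      simp [abs_of_nonneg hs.1]
    have h2 : ∫ s in (0 : ℝ)..t, Real.exp (Λ * s) = (Real.exp (Λ * t) - 1) / Λ := by
      rw [intervalIntegral.integral_comp_mul_left (fun x => Real.exp x) hΛ.ne']
      simp [div_eq_inv_mul]
    rw [h1, h2, abs_of_nonneg, abs_of_nonneg ht]
    · gcongr; linarith
    · apply div_nonneg _ hΛ.le
      have : 0 ≤ Λ * t := by positivity
      linarith [Real.add_one_le_exp (Λ * t)]
  rcases le_total 0 t with h | h
  · exact key t h
  · have h1 := intervalIntegral.integral_comp_neg (a := 0) (b := -t)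
      (fun s => Real.exp (Λ * |s|))
    simp only [abs_neg, neg_neg, neg_zero] at h1
    have := key (-t) (by linarith)
    rwa [h1, intervalIntegral.integral_symm, abs_neg, abs_neg] at this

variable [CompleteSpace E]

/-- A globally Lipschitz continuous field has a solution on every bounded time interval. -/
theorem exists_solution_Ioo {f : ℝ → E → E} {K : ℝ≥0} (hf : ∀ t, LipschitzWith K (f t))
    (hc : Continuous fun q : ℝ × E => f q.1 q.2) (x₀ : E) {T : ℝ} (hT : 0 < T) :
    ∃ u : ℝ → E, u 0 = x₀ ∧ ∀ t ∈ Ioo (-T) T, HasDerivAt u (f t (u t)) t := by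
  have hTT : -T ≤ T := by linarith
  -- The fixed point is sought for `w = exp(-Λ|t|) u`. In this weighted sup norm the Picard map has
  -- Lipschitz constant `K / Λ ≤ 1/2` on the whole interval, whatever its length.
  set Λ : ℝ := 2 * K + 1 with hΛ
  have hK : (0 : ℝ) ≤ K := K.2
  have hΛ0 : 0 < Λ := by positivity
  let ext : C(Icc (-T) T, E) → ℝ → E := fun w s => Real.exp (Λ * |s|) • w (projIcc (-T) T hTT s)
  have ext_cont : ∀ w, Continuous (ext w) := fun w => by
    have : Continuous fun s => w (projIcc (-T) T hTT s) := w.continuous.comp continuous_projIcc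
    fun_prop
  let sol : C(Icc (-T) T, E) → ℝ → E := fun w t => x₀ + ∫ s in (0 : ℝ)..t, f s (ext w s)
  have int_cont : ∀ w, Continuous fun s => f s (ext w s) := fun w =>
    hc.comp (continuous_id.prodMk (ext_cont w))
  have sol_deriv : ∀ w t, HasDerivAt (sol w) (f t (ext w t)) t := fun w t =>
    ((int_cont w).integral_hasStrictDerivAt 0 t).hasDerivAt.const_add x₀
  have sol_cont : ∀ w, Continuous (sol w) := fun w =>
    continuous_iff_continuousAt.2 fun t => (sol_deriv w t).continuousAt
  let Φ : C(Icc (-T) T, E) → C(Icc (-T) T, E) := fun w =>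
    ⟨fun t => Real.exp (-(Λ * |(t : ℝ)|)) • sol w t, by
      have := (sol_cont w).comp (continuous_subtype_val (p := fun t => t ∈ Icc (-T) T))
      have h2 : Continuous fun t : Icc (-T) T => Real.exp (-(Λ * |(t : ℝ)|)) := by fun_prop
      exact h2.smul this⟩
  have hΦ : ContractingWith (1 / 2) Φ := by
    refine ⟨by rw [← NNReal.coe_lt_coe]; norm_num, LipschitzWith.of_dist_le_mul fun w w' => ?_⟩
    rw [ContinuousMap.dist_le (by positivity)]
    intro t
    have h1 : ‖sol w t - sol w' t‖ ≤ K * dist w w' * (Real.exp (Λ * |(t : ℝ)|) / Λ) := by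
      have h2 : sol w t - sol w' t = ∫ s in (0 : ℝ)..t, (f s (ext w s) - f s (ext w' s)) := by
        rw [intervalIntegral.integral_sub ((int_cont w).intervalIntegrable _ _)
          ((int_cont w').intervalIntegrable _ _)]
        simp [sol]
      rw [h2]
      have h3 : ‖∫ s in (0 : ℝ)..t, (f s (ext w s) - f s (ext w' s))‖ ≤
          |∫ s in (0 : ℝ)..t, K * dist w w' * Real.exp (Λ * |s|)| := by
        apply intervalIntegral.norm_integral_le_abs_of_norm_le
        · refine Eventually.of_forall fun s => ?_
          rw [← dist_eq_norm]
          refine ((hf s).dist_le_mul _ _).trans ?_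
          simp only [ext]
          rw [dist_smul₀, Real.norm_of_nonneg (Real.exp_pos _).le, mul_assoc,
            mul_comm (dist w w')]
          gcongr
          exact ContinuousMap.dist_apply_le_dist _
        · exact (by fun_prop : Continuous fun s : ℝ =>
            K * dist w w' * Real.exp (Λ * |s|)).intervalIntegrable _ _
      refine h3.trans ?_
      rw [intervalIntegral.integral_const_mul, abs_mul, abs_of_nonneg (by positivity)]
      gcongr
      exact abs_integral_exp_abs_le hΛ0 t
    change dist (Real.exp (-(Λ * |(t : ℝ)|)) • sol w t) (Real.exp (-(Λ * |(t : ℝ)|)) • sol w' t) ≤ _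
    rw [dist_smul₀, Real.norm_of_nonneg (Real.exp_pos _).le, dist_eq_norm]
    have h4 : Real.exp (-(Λ * |(t : ℝ)|)) * Real.exp (Λ * |(t : ℝ)|) = 1 := by
      rw [← Real.exp_add]; simp
    calc Real.exp (-(Λ * |(t : ℝ)|)) * ‖sol w t - sol w' t‖
        ≤ Real.exp (-(Λ * |(t : ℝ)|)) * (K * dist w w' * (Real.exp (Λ * |(t : ℝ)|) / Λ)) := by
          gcongr
      _ = (Real.exp (-(Λ * |(t : ℝ)|)) * Real.exp (Λ * |(t : ℝ)|)) * (K / Λ * dist w w') := by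
          ring
      _ ≤ _ := by
          rw [h4, one_mul]
          gcongr
          rw [div_le_iff₀ hΛ0]
          simp [hΛ]
          linarith
  obtain ⟨w, hw⟩ : ∃ w, Φ w = w := ⟨_, hΦ.fixedPoint_isFixedPt⟩
  refine ⟨sol w, by simp [sol], fun t ht => ?_⟩
  have h5 : ext w t = sol w t := by
    have hmem : t ∈ Icc (-T) T := Ioo_subset_Icc_self ht
    simp only [ext]
    rw [projIcc_of_mem hTT hmem]
    conv_lhs => rw [← hw]
    change Real.exp (Λ * |t|) • Real.exp (-(Λ * |t|)) • sol w t = sol w t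
    rw [smul_smul, ← Real.exp_add]
    simp
  rw [← h5]
  exact sol_deriv w t

/-- A globally Lipschitz continuous field has global solutions. -/
theorem exists_global_solution {f : ℝ → E → E} {K : ℝ≥0} (hf : ∀ t, LipschitzWith K (f t))
    (hc : Continuous fun q : ℝ × E => f q.1 q.2) (x₀ : E) :
    ∃ u : ℝ → E, u 0 = x₀ ∧ ∀ t, HasDerivAt u (f t (u t)) t := by
  have h : ∀ T : ℝ, ∃ u : ℝ → E, u 0 = x₀ ∧
      ∀ t ∈ Ioo (-(|T| + 1)) (|T| + 1), HasDerivAt u (f t (u t)) t :=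
    fun T => exists_solution_Ioo hf hc x₀ (by positivity)
  choose u hu0 hu using h
  have huniq : ∀ S T : ℝ, |S| ≤ |T| → EqOn (u S) (u T) (Ioo (-(|S| + 1)) (|S| + 1)) := by
    intro S T hST
    have hpos : 0 < |S| + 1 := by positivity
    apply ODE_solution_unique_of_mem_Ioo (v := f) (s := fun _ => univ) (K := K) (t₀ := 0)
      (fun t _ => (hf t).lipschitzOnWith) ⟨by linarith, hpos⟩
      (fun t ht => ⟨hu S t ht, trivial⟩)
      (fun t ht => ⟨hu T t ⟨by linarith [ht.1], by linarith [ht.2]⟩, trivial⟩)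
    rw [hu0, hu0]
  -- `u T` solves the equation on a symmetric interval containing `T`; by uniqueness these solutions
  -- agree on overlaps, so the diagonal glues them.
  refine ⟨fun t => u t t, hu0 0, fun t => ?_⟩
  have hmem : t ∈ Ioo (-(|t| + 1)) (|t| + 1) := abs_lt.1 (lt_add_one _)
  refine (hu t t hmem).congr_of_eventuallyEq ?_
  filter_upwards [Ioo_mem_nhds hmem.1 hmem.2] with s hs
  have hs1 : s ∈ Ioo (-(|s| + 1)) (|s| + 1) := abs_lt.1 (lt_add_one _)
  rcases le_total |s| |t| with h | h
  · exact huniq s t h hs1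
  · exact (huniq t s h hs).symm

end ODE

/-! ### Smooth dependence of ODE solutions on a real parameter. -/

section Parameter

variable {E : Type*} [NormedAddCommGroup E] [NormedSpace ℝ E]

omit [NormedSpace ℝ E] in
theorem eventually_forall_norm_sub_le {D : ℝ × ℝ → E} (hD : Continuous D) (r T : ℝ) {ε : ℝ}
    (hε : 0 < ε) : ∀ᶠ s in 𝓝 r, ∀ t ∈ Icc (-T) T, ‖D (s, t) - D (r, t)‖ ≤ ε := by
  apply isCompact_Icc.eventually_forall_of_forall_eventually
  intro t _
  have hc : Continuous fun z : ℝ × ℝ => ‖D (z.1, z.2) - D (r, z.2)‖ := by fun_prop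
  have := hc.tendsto (r, t)
  simp only [sub_self, norm_zero] at this
  exact (this.eventually (gt_mem_nhds hε)).mono fun z hz => hz.le

theorem exists_pos_mul_le (C : ℝ) (hC : 0 ≤ C) {ε : ℝ} (hε : 0 < ε) :
    ∃ η : ℝ, 0 < η ∧ η * C ≤ ε := by
  refine ⟨ε / (C + 1), by positivity, ?_⟩
  rw [div_mul_eq_mul_div, div_le_iff₀ (by positivity)]
  nlinarith

variable {G : ℝ × ℝ × E → E} {K : ℝ≥0} {u : ℝ → ℝ → E}

/-- Solutions depend continuously on time and on a parameter. -/
theorem continuous_solution (hLip : ∀ r t, LipschitzWith K fun x => G (r, t, x))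
    (hG : Continuous G) (hu₀ : Continuous fun r => u r 0)
    (hu : ∀ r t, HasDerivAt (u r) (G (r, t, u r t)) t) :
    Continuous fun q : ℝ × ℝ => u q.1 q.2 := by
  rw [continuous_iff_continuousAt]
  rintro ⟨r, t₀⟩
  set T : ℝ := |t₀| + 1 with hT
  have hTpos : 0 < T := by positivity
  have hur : Continuous (u r) := continuous_iff_continuousAt.2 fun t => (hu r t).continuousAt
  rw [ContinuousAt, tendsto_iff_norm_sub_tendsto_zero]
  have h1 : Tendsto (fun q : ℝ × ℝ => ‖u r q.2 - u r t₀‖) (𝓝 (r, t₀)) (𝓝 0) := by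
    have hc : Continuous fun q : ℝ × ℝ => ‖u r q.2 - u r t₀‖ := by fun_prop
    simpa using hc.tendsto (r, t₀)
  have h2 : Tendsto (fun q : ℝ × ℝ => ‖u q.1 q.2 - u r q.2‖) (𝓝 (r, t₀)) (𝓝 0) := by
    rw [Metric.tendsto_nhds]
    intro ε hε
    obtain ⟨η, hη, hηε⟩ := exists_pos_mul_le ((1 + T) * Real.exp (K * T)) (by positivity)
      (half_pos hε)
    -- The trajectory with parameter `r` solves the equation with parameter `s` up to a defect `η`.
    have e1 : ∀ᶠ s in 𝓝 r, ∀ t ∈ Icc (-T) T, ‖G (s, t, u r t) - G (r, t, u r t)‖ ≤ η :=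
      eventually_forall_norm_sub_le (D := fun q => G (q.1, q.2, u r q.2)) (by fun_prop) r T hη
    have e2 : ∀ᶠ s in 𝓝 r, ‖u s 0 - u r 0‖ ≤ η := by
      have := (tendsto_iff_norm_sub_tendsto_zero.1 (hu₀.tendsto r)).eventually (gt_mem_nhds hη)
      exact this.mono fun _ h => h.le
    have e3 : ∀ᶠ t in 𝓝 t₀, t ∈ Icc (-T) T := by
      have := abs_lt.1 (lt_add_one |t₀|)
      exact Icc_mem_nhds this.1 this.2
    rw [nhds_prod_eq]
    filter_upwards [(e1.and e2).prod_mk e3] with q hq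
    obtain ⟨⟨h1, h2⟩, h3⟩ := hq
    rw [dist_zero_right, norm_norm]
    have := norm_sub_le_of_approx (f := fun t x => G (q.1, t, x)) (hLip q.1) (hu q.1) (hu r)
      hη.le h2 (fun t ht => by rw [norm_sub_rev]; exact h1 t ht) q.2 h3
    have h4 : (η + η * T) * Real.exp (K * T) = η * ((1 + T) * Real.exp (K * T)) := by ring
    linarith
  refine squeeze_zero (fun _ => norm_nonneg _) (fun q => ?_) (by simpa using h2.add h1)
  exact norm_sub_le_norm_sub_add_norm_sub _ _ _

/-- The solution is differentiable with respect to the parameter, and the derivative is the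
solution of the linearized equation. -/
theorem hasDerivAt_solution_param (hLip : ∀ r t, LipschitzWith K fun x => G (r, t, x))
    (hG : ContDiff ℝ 1 G) (hu : ∀ r t, HasDerivAt (u r) (G (r, t, u r t)) t)
    {r : ℝ} {v : ℝ → E} (hu₀ : HasDerivAt (fun s => u s 0) (v 0) r)
    (hv : ∀ t, HasDerivAt v (fderiv ℝ G (r, t, u r t) (1, 0, v t)) t) (t₀ : ℝ) :
    HasDerivAt (fun s => u s t₀) (v t₀) r := by
  set T : ℝ := |t₀| with hT
  have hTpos : 0 ≤ T := abs_nonneg _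
  have hur : Continuous (u r) := continuous_iff_continuousAt.2 fun t => (hu r t).continuousAt
  have hvc : Continuous v := continuous_iff_continuousAt.2 fun t => (hv t).continuousAt
  -- `D (s, t)` is the `s`-derivative of the field along `u r + (s - r) v`; at `s = r` it is the
  -- right-hand side of the linearized equation. Its continuity makes the defect of this first-order
  -- approximation `o(s - r)`, uniformly in `t`.
  let D : ℝ × ℝ → E := fun q => fderiv ℝ G (q.1, q.2, u r q.2 + (q.1 - r) • v q.2) (1, 0, v q.2)
  have hD : Continuous D := by
    have hc := hG.continuous_fderiv one_ne_zero
    have h1 : Continuous fun q : ℝ × ℝ =>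
        fderiv ℝ G (q.1, q.2, u r q.2 + (q.1 - r) • v q.2) := hc.comp (by fun_prop)
    exact h1.clm_apply (by fun_prop)
  have hΦ : ∀ t s, HasDerivAt (fun s => G (s, t, u r t + (s - r) • v t)) (D (s, t)) s := by
    intro t s
    have h1 : HasDerivAt (fun s : ℝ => (s, t, u r t + (s - r) • v t)) (1, 0, v t) s := by
      refine (hasDerivAt_id s).prodMk ((hasDerivAt_const s t).prodMk ?_)
      simpa using (((hasDerivAt_id s).sub_const r).smul_const (v t)).const_add (u r t)
    exact ((hG.differentiable one_ne_zero _).hasFDerivAt).comp_hasDerivAt s h1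
  rw [hasDerivAt_iff_isLittleO, Asymptotics.isLittleO_iff]
  intro c hc
  obtain ⟨η, hη, hηc⟩ := exists_pos_mul_le ((1 + T) * Real.exp (K * T)) (by positivity) hc
  have e1 := eventually_forall_norm_sub_le hD r T hη
  have e2 := (Asymptotics.isLittleO_iff.1 (hasDerivAt_iff_isLittleO.1 hu₀)) hη
  obtain ⟨δ, hδ, hball⟩ := Metric.eventually_nhds_iff_ball.1 e1
  filter_upwards [e2, Metric.ball_mem_nhds r hδ] with s hs0 hsb
  have hrb : r ∈ Metric.ball r δ := Metric.mem_ball_self hδ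
  have key : ∀ t ∈ Icc (-T) T,
      ‖G (r, t, u r t) + (s - r) • fderiv ℝ G (r, t, u r t) (1, 0, v t)
        - G (s, t, u r t + (s - r) • v t)‖ ≤ η * ‖s - r‖ := by
    intro t ht
    have := (convex_ball r δ).norm_image_sub_le_of_norm_hasDerivWithin_le
      (f := fun s => G (s, t, u r t + (s - r) • v t) - s • D (r, t))
      (f' := fun s => D (s, t) - D (r, t)) (C := η)
      (fun x _ => by
        have := ((hasDerivAt_id x).smul_const (D (r, t)))
        rw [one_smul] at this
        exact ((hΦ t x).sub this).hasDerivWithinAt)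
      (fun x hx => hball x hx t ht) hrb hsb
    have hDr : fderiv ℝ G (r, t, u r t) (1, 0, v t) = D (r, t) := by simp [D]
    rw [hDr, norm_sub_rev]
    refine le_trans (le_of_eq ?_) this
    congr 1
    simp only [sub_self, zero_smul, add_zero, sub_smul]
    abel
  have fin := norm_sub_le_of_approx (f := fun t x => G (s, t, x)) (hLip s) (hu s)
    (g := fun t => u r t + (s - r) • v t) (fun t => (hu r t).add ((hv t).const_smul (s - r)))
    (T := T) (δ := η * ‖s - r‖) (ε := η * ‖s - r‖) (by positivity)
    (by rw [← sub_sub]; exact hs0) key t₀ ⟨neg_abs_le t₀, le_abs_self t₀⟩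
  rw [← sub_sub] at fin
  refine fin.trans ?_
  calc (η * ‖s - r‖ + η * ‖s - r‖ * T) * Real.exp (K * T)
      = η * ((1 + T) * Real.exp (K * T)) * ‖s - r‖ := by ring
    _ ≤ c * ‖s - r‖ := by gcongr

/-- In a difference the component `(1, 0)` cancels, leaving the partial derivative of `G` in the
state, of norm at most `K`. The linearized equation therefore keeps the same Lipschitz constant. -/
theorem lipschitzWith_fderiv_apply (hLip : ∀ r t, LipschitzWith K fun x => G (r, t, x))
    (hG : ContDiff ℝ 1 G) (q : ℝ × ℝ × E) :
    LipschitzWith K fun x => fderiv ℝ G q (1, 0, x) := by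
  obtain ⟨r, t, y⟩ := q
  apply LipschitzWith.of_dist_le_mul
  intro x x'
  have h1 : HasFDerivAt (fun x => G (r, t, x))
      ((fderiv ℝ G (r, t, y)).comp ((0 : E →L[ℝ] ℝ).prod
        ((0 : E →L[ℝ] ℝ).prod (ContinuousLinearMap.id ℝ E)))) y :=
    HasFDerivAt.comp y ((hG.differentiable one_ne_zero _).hasFDerivAt)
      ((hasFDerivAt_const r y).prodMk ((hasFDerivAt_const t y).prodMk (hasFDerivAt_id y)))
  have h2 := h1.le_of_lipschitz (hLip r t)
  rw [dist_eq_norm, dist_eq_norm, ← map_sub]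
  have h3 := ContinuousLinearMap.le_of_opNorm_le _ h2 (x - x')
  simpa using h3

variable [CompleteSpace E]

theorem exists_linearized_solution (hLip : ∀ r t, LipschitzWith K fun x => G (r, t, x))
    (hG : ContDiff ℝ 1 G) {γ : ℝ → E} (hγ : Continuous γ) (r : ℝ) (v₀ : E) :
    ∃ v : ℝ → E, v 0 = v₀ ∧ ∀ t, HasDerivAt v (fderiv ℝ G (r, t, γ t) (1, 0, v t)) t := by
  apply exists_global_solution (K := K) (f := fun t x => fderiv ℝ G (r, t, γ t) (1, 0, x))
    (fun t => lipschitzWith_fderiv_apply hLip hG _)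
  have hc := hG.continuous_fderiv one_ne_zero
  have h1 : Continuous fun q : ℝ × E => fderiv ℝ G (r, q.1, γ q.1) := hc.comp (by fun_prop)
  exact h1.clm_apply (by fun_prop)

/-- Induction on `k`, with `G` and `u` generalized: the parameter derivative `v` solves a Lipschitz
equation in the same space with a `C^k` field, so the induction hypothesis applies to it. The time
derivative is `G` along `u`. Both partial derivatives being `C^k`, `u` is `C^(k+1)`. -/
theorem contDiff_nat_solution (k : ℕ) : ∀ {G : ℝ × ℝ × E → E} {u : ℝ → ℝ → E},
    (∀ r t, LipschitzWith K fun x => G (r, t, x)) → ContDiff ℝ k G →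
    ContDiff ℝ k (fun r => u r 0) → (∀ r t, HasDerivAt (u r) (G (r, t, u r t)) t) →
    ContDiff ℝ k fun q : ℝ × ℝ => u q.1 q.2 := by
  induction k with
  | zero =>
    intro G u hLip hG hu₀ hu
    simp only [CharP.cast_eq_zero, contDiff_zero] at *
    exact continuous_solution hLip hG hu₀ hu
  | succ k ih =>
    intro G u hLip hG hu₀ hu
    have hG1 : ContDiff ℝ 1 G := hG.of_le (by simp)
    have huk := ih hLip (hG.of_le (by simp)) (hu₀.of_le (by simp)) hu
    have hu₀' : ContDiff ℝ k (deriv fun r => u r 0) :=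
      ((contDiff_succ_iff_deriv (n := k)).1 (by exact_mod_cast hu₀)).2.2
    have hur : ∀ r, Continuous (u r) := fun r =>
      continuous_iff_continuousAt.2 fun t => (hu r t).continuousAt
    choose v hv0 hv using fun r =>
      exists_linearized_solution hLip hG1 (hur r) r (deriv (fun r => u r 0) r)
    have hvk : ContDiff ℝ k fun q : ℝ × ℝ => v q.1 q.2 := by
      apply ih (G := fun q => fderiv ℝ G (q.1, q.2.1, u q.1 q.2.1) (1, 0, q.2.2))
        (fun r t => by simpa using lipschitzWith_fderiv_apply hLip hG1 (r, t, u r t)) _ (by simpa only [hv0] using hu₀') hv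
      have h1 : ContDiff ℝ k (fderiv ℝ G) := hG.fderiv_right (by norm_cast)
      have h2 : ContDiff ℝ k fun q : ℝ × ℝ × E => (q.1, q.2.1, u q.1 q.2.1) :=
        contDiff_fst.prodMk ((contDiff_fst.comp contDiff_snd).prodMk
          (huk.comp (contDiff_fst.prodMk (contDiff_fst.comp contDiff_snd))))
      exact (h1.comp h2).clm_apply
        (contDiff_const.prodMk (contDiff_const.prodMk (contDiff_snd.comp contDiff_snd)))
    have hGu : ContDiff ℝ k fun q : ℝ × ℝ => G (q.1, q.2, u q.1 q.2) :=
      (hG.of_le (by simp)).comp (contDiff_fst.prodMk (contDiff_snd.prodMk huk))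
    have hd1 : ∀ q : ℝ × ℝ, HasFDerivAt (fun s => u s q.2)
        (ContinuousLinearMap.toSpanSingleton ℝ (v q.1 q.2)) q.1 := fun q =>
      (hasDerivAt_solution_param hLip hG1 hu (by
        rw [hv0]; exact (hu₀.differentiable (by simp) _).hasDerivAt) (hv q.1) q.2).hasFDerivAt
    have hd2 : ∀ q : ℝ × ℝ, HasFDerivAt (u q.1)
        (ContinuousLinearMap.toSpanSingleton ℝ (G (q.1, q.2, u q.1 q.2))) q.2 := fun q =>
      (hu q.1 q.2).hasFDerivAt
    have htss : ∀ {w : ℝ × ℝ → E}, ContDiff ℝ k w →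
        ContDiff ℝ k fun q => ContinuousLinearMap.toSpanSingleton ℝ (w q) := fun hw =>
      (ContinuousLinearMap.toSpanSingletonCLE (𝕜 := ℝ) (E := E)).contDiff.comp hw
    have key := (contDiff_succ_iff_hasFDerivAt (𝕜 := ℝ) (n := k)
      (f := fun q : ℝ × ℝ => u q.1 q.2)).2
    push_cast
    refine key ⟨fun q => (ContinuousLinearMap.toSpanSingleton ℝ (v q.1 q.2)).coprod
      (ContinuousLinearMap.toSpanSingleton ℝ (G (q.1, q.2, u q.1 q.2))), ?_, fun q => ?_⟩
    · have h1 := ((htss hvk).clm_comp (contDiff_const (c := ContinuousLinearMap.fst ℝ ℝ ℝ))).add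
        ((htss hGu).clm_comp (contDiff_const (c := ContinuousLinearMap.snd ℝ ℝ ℝ)))
      convert h1 using 1
      funext q
      ext <;> simp
    · exact (hasStrictFDerivAt_uncurry_coprod (f := u)
        (f₁ := fun r t => ContinuousLinearMap.toSpanSingleton ℝ (v r t))
        (f₂ := fun r t => ContinuousLinearMap.toSpanSingleton ℝ (G (r, t, u r t)))
        (Eventually.of_forall hd1) (Eventually.of_forall hd2)
        (htss hvk).continuous.continuousAt (htss hGu).continuous.continuousAt).hasFDerivAt

/-- Solutions of an ordinary differential equation with a globally Lipschitz right-hand side of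
class `Cⁿ` and initial data of class `Cⁿ` in a real parameter are jointly `Cⁿ`. -/
theorem contDiff_solution {n : ℕ∞} (hLip : ∀ r t, LipschitzWith K fun x => G (r, t, x))
    (hG : ContDiff ℝ n G) (hu₀ : ContDiff ℝ n fun r => u r 0)
    (hu : ∀ r t, HasDerivAt (u r) (G (r, t, u r t)) t) :
    ContDiff ℝ n fun q : ℝ × ℝ => u q.1 q.2 := by
  rw [contDiff_iff_forall_nat_le]
  intro m hm
  have hm' : (m : WithTop ℕ∞) ≤ n := by exact_mod_cast hm
  exact contDiff_nat_solution m hLip (hG.of_le hm') (hu₀.of_le hm') hu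

end Parameter

/-! ### The velocity function and the factor `√(1 + p²)`. -/

section Velocity

theorem contDiff_velocity {n : WithTop ℕ∞} : ContDiff ℝ n velocity := by
  have h : ∀ p : ℝ, 1 + p ^ 2 ≠ 0 := fun p => by positivity
  exact contDiff_id.div ((contDiff_const.add (contDiff_id.pow 2)).sqrt h)
    fun p => (Real.sqrt_pos.2 (by positivity)).ne'

theorem hasDerivAt_gamma (p : ℝ) :
    HasDerivAt (fun p : ℝ => Real.sqrt (1 + p ^ 2)) (velocity p) p := by
  have h : HasDerivAt (fun p : ℝ => 1 + p ^ 2) (2 * p) p := by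
    simpa using (hasDerivAt_pow 2 p).const_add 1
  convert h.sqrt (by positivity) using 1
  rw [velocity]
  ring

theorem hasDerivAt_velocity (p : ℝ) :
    HasDerivAt velocity (1 / Real.sqrt (1 + p ^ 2) ^ 3) p := by
  have hs : 0 < Real.sqrt (1 + p ^ 2) := Real.sqrt_pos.2 (by positivity)
  have hsq : Real.sqrt (1 + p ^ 2) ^ 2 = 1 + p ^ 2 := Real.sq_sqrt (by positivity)
  have h := (hasDerivAt_id p).div (hasDerivAt_gamma p) hs.ne'
  refine h.congr_deriv ?_
  rw [velocity]
  simp only [id]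
  field_simp
  linarith

theorem one_le_gamma (p : ℝ) : 1 ≤ Real.sqrt (1 + p ^ 2) := by
  rw [Real.one_le_sqrt]
  nlinarith [sq_nonneg p]

theorem one_div_gamma_pow_le_one (p : ℝ) : 1 / Real.sqrt (1 + p ^ 2) ^ 3 ≤ 1 := by
  rw [div_le_one (by have := one_le_gamma p; positivity)]
  exact one_le_pow₀ (one_le_gamma p)

theorem one_sub_le_one_div_pow {x : ℝ} (hx : 1 ≤ x) : 1 - 3 * (x - 1) ≤ 1 / x ^ 3 := by
  rw [le_div_iff₀ (by positivity)]
  obtain ⟨y, rfl⟩ : ∃ y, x = 1 + y := ⟨x - 1, by ring⟩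
  have hy : 0 ≤ y := by linarith
  have : 0 ≤ 6 * y ^ 2 + 8 * y ^ 3 + 3 * y ^ 4 := by positivity
  nlinarith

theorem abs_velocity_sub_le (p q : ℝ) : |velocity p - velocity q| ≤ |p - q| := by
  have := convex_univ.norm_image_sub_le_of_norm_hasDerivWithin_le (C := 1) (f := velocity)
    (fun x _ => (hasDerivAt_velocity x).hasDerivWithinAt)
    (fun x _ => by
      rw [Real.norm_of_nonneg (by positivity)]
      exact one_div_gamma_pow_le_one x) (mem_univ q) (mem_univ p)
  simpa using this

end Velocity

/-! ### Solutions along characteristics. -/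

/-- `p` and `e` are the momentum and the field along the characteristics, as functions of the
initial position and of time; `a` and `b` are their derivatives in the initial position. -/
structure IsLagrangianSolution (ν : ℝ) (n : ℕ∞) (P₀ E₀ : ℝ → ℝ) (p e a b : ℝ → ℝ → ℝ) :
    Prop where
  contDiff_p : ContDiff ℝ n fun q : ℝ × ℝ => p q.1 q.2
  contDiff_e : ContDiff ℝ n fun q : ℝ × ℝ => e q.1 q.2
  init_p : ∀ r, p r 0 = P₀ r
  init_e : ∀ r, e r 0 = E₀ r
  init_a : ∀ r, a r 0 = deriv P₀ r
  init_b : ∀ r, b r 0 = deriv E₀ r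
  deriv_p : ∀ r t, HasDerivAt (p r) (-e r t - ν * p r t) t
  deriv_e : ∀ r t, HasDerivAt (e r) (velocity (p r t)) t
  deriv_a : ∀ r t, HasDerivAt (a r) (-b r t - ν * a r t) t
  deriv_b : ∀ r t, HasDerivAt (b r) (1 / Real.sqrt (1 + p r t ^ 2) ^ 3 * a r t) t
  param_e : ∀ r t, HasDerivAt (fun s => e s t) (b r t) r

theorem lipschitzWith_plasmaField {ν : ℝ} (hν : 0 ≤ ν) :
    LipschitzWith ⟨1 + ν, by linarith⟩ fun x : ℝ × ℝ => (-x.2 - ν * x.1, velocity x.1) := by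
  apply LipschitzWith.of_dist_le_mul
  rintro ⟨p, e⟩ ⟨p', e'⟩
  change _ ≤ (1 + ν) * _
  simp only [Prod.dist_eq, Real.dist_eq]
  set m := max |p - p'| |e - e'|
  have h1 : |p - p'| ≤ m := le_max_left _ _
  have h2 : |e - e'| ≤ m := le_max_right _ _
  have hm : 0 ≤ m := (abs_nonneg _).trans h1
  apply max_le
  · have : -e - ν * p - (-e' - ν * p') = -(e - e') - ν * (p - p') := by ring
    rw [this]
    refine (abs_sub _ _).trans ?_
    rw [abs_neg, abs_mul, abs_of_nonneg hν]
    nlinarith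
  · exact (abs_velocity_sub_le p p').trans (by nlinarith)

theorem exists_lagrangianSolution {ν : ℝ} (hν : 0 ≤ ν) {n : ℕ∞} (hn : 1 ≤ n) {P₀ E₀ : ℝ → ℝ}
    (hP : ContDiff ℝ n P₀) (hE : ContDiff ℝ n E₀) :
    ∃ p e a b, IsLagrangianSolution ν n P₀ E₀ p e a b := by
  let G : ℝ × ℝ × (ℝ × ℝ) → ℝ × ℝ := fun q => (-q.2.2.2 - ν * q.2.2.1, velocity q.2.2.1)
  have hn1 : (1 : WithTop ℕ∞) ≤ n := by exact_mod_cast hn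
  have hLip : ∀ r t : ℝ, LipschitzWith ⟨1 + ν, by linarith⟩ fun x => G (r, t, x) :=
    fun _ _ => lipschitzWith_plasmaField hν
  have hG : ∀ {m : WithTop ℕ∞}, ContDiff ℝ m G := by
    intro m
    have hv : ContDiff ℝ m velocity := contDiff_velocity
    have h1 : ContDiff ℝ m fun q : ℝ × ℝ × (ℝ × ℝ) => q.2.2.1 := by fun_prop
    have h2 : ContDiff ℝ m fun q : ℝ × ℝ × (ℝ × ℝ) => q.2.2.2 := by fun_prop
    exact (h2.neg.sub (contDiff_const.mul h1)).prodMk (hv.comp h1)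
  -- `G` depends on neither parameter nor time, so differentiating along the line `q + s (1, 0, w)`
  -- sees only `w`.
  have hDG : ∀ (q : ℝ × ℝ × (ℝ × ℝ)) (w : ℝ × ℝ), fderiv ℝ G q (1, 0, w) =
      (-w.2 - ν * w.1, 1 / Real.sqrt (1 + q.2.2.1 ^ 2) ^ 3 * w.1) := by
    intro q w
    have h1 : HasDerivAt (fun s : ℝ => q + s • ((1, 0, w) : ℝ × ℝ × (ℝ × ℝ))) (1, 0, w) 0 := by
      simpa using ((hasDerivAt_id (0 : ℝ)).smul_const
        ((1, 0, w) : ℝ × ℝ × (ℝ × ℝ))).const_add q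
    have h2 : HasFDerivAt G (fderiv ℝ G q) (q + (0 : ℝ) • ((1, 0, w) : ℝ × ℝ × (ℝ × ℝ))) := by
      rw [zero_smul, add_zero]
      exact (hG.differentiable one_ne_zero q).hasFDerivAt
    have h3 := h2.comp_hasDerivAt (0 : ℝ) h1
    have hp : HasDerivAt (fun s : ℝ => q.2.2.1 + s * w.1) w.1 0 := by
      simpa using ((hasDerivAt_id (0 : ℝ)).mul_const w.1).const_add q.2.2.1
    have he : HasDerivAt (fun s : ℝ => q.2.2.2 + s * w.2) w.2 0 := by
      simpa using ((hasDerivAt_id (0 : ℝ)).mul_const w.2).const_add q.2.2.2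
    have hV : HasDerivAt velocity (1 / Real.sqrt (1 + q.2.2.1 ^ 2) ^ 3)
        (q.2.2.1 + 0 * w.1) := by
      rw [zero_mul, add_zero]
      exact hasDerivAt_velocity _
    have h4 := (he.neg.sub (hp.const_mul ν)).prodMk (hV.comp (0 : ℝ) hp)
    exact h3.unique h4
  choose u hu0 hu using fun r => exists_global_solution (E := ℝ × ℝ)
    (f := fun _ x => (-x.2 - ν * x.1, velocity x.1)) (fun _ => lipschitzWith_plasmaField hν)
    (((lipschitzWith_plasmaField hν).continuous).comp continuous_snd) (P₀ r, E₀ r)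
  have hu' : ∀ r t, HasDerivAt (u r) (G (r, t, u r t)) t := hu
  have hur : ∀ r, Continuous (u r) := fun r =>
    continuous_iff_continuousAt.2 fun t => (hu r t).continuousAt
  choose v hv0 hv using fun r => exists_linearized_solution hLip hG (hur r) r
    (deriv P₀ r, deriv E₀ r)
  have hu0' : (fun r => u r 0) = fun r => (P₀ r, E₀ r) := funext hu0
  have huC : ContDiff ℝ n fun q : ℝ × ℝ => u q.1 q.2 :=
    contDiff_solution hLip hG (by rw [hu0']; exact hP.prodMk hE) hu'
  have hur : ∀ r t, HasDerivAt (fun s => u s t) (v r t) r := fun r t =>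
    hasDerivAt_solution_param hLip hG hu' (by
      rw [hu0', hv0]
      exact ((hP.differentiable (by positivity) r).hasDerivAt).prodMk
        ((hE.differentiable (by positivity) r).hasDerivAt)) (hv r) t
  simp only [hDG] at hv
  refine ⟨fun r t => (u r t).1, fun r t => (u r t).2, fun r t => (v r t).1,
    fun r t => (v r t).2, ?_⟩
  have hfst : ∀ {f : ℝ → ℝ × ℝ} {f' : ℝ × ℝ} {x : ℝ}, HasDerivAt f f' x →
      HasDerivAt (fun x => (f x).1) f'.1 x := fun h =>
    (ContinuousLinearMap.fst ℝ ℝ ℝ).hasFDerivAt.comp_hasDerivAt _ h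
  have hsnd : ∀ {f : ℝ → ℝ × ℝ} {f' : ℝ × ℝ} {x : ℝ}, HasDerivAt f f' x →
      HasDerivAt (fun x => (f x).2) f'.2 x := fun h =>
    (ContinuousLinearMap.snd ℝ ℝ ℝ).hasFDerivAt.comp_hasDerivAt _ h
  constructor
  · exact contDiff_fst.comp huC
  · exact contDiff_snd.comp huC
  · simp [hu0]
  · simp [hu0]
  · simp [hv0]
  · simp [hv0]
  · exact fun r t => hfst (hu r t)
  · exact fun r t => hsnd (hu r t)
  · exact fun r t => hfst (hv r t)
  · exact fun r t => hsnd (hv r t)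
  · exact fun r t => hsnd (hur r t)

/-! ### A priori estimates. -/

theorem le_of_hasDerivAt_nonpos {f f' : ℝ → ℝ} (hf : ∀ t, HasDerivAt f (f' t) t)
    (h : ∀ t, 0 ≤ t → f' t ≤ 0) {t : ℝ} (ht : 0 ≤ t) : f t ≤ f 0 := by
  have hc : Continuous f := continuous_iff_continuousAt.2 fun t => (hf t).continuousAt
  refine antitoneOn_of_deriv_nonpos (convex_Ici 0) hc.continuousOn
    (fun x _ => (hf x).differentiableAt.differentiableWithinAt) (fun x hx => ?_)
    (self_mem_Ici) ht ht
  rw [interior_Ici] at hx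
  rw [(hf x).deriv]
  exact h x (le_of_lt hx)

namespace IsLagrangianSolution

variable {ν : ℝ} {n : ℕ∞} {P₀ E₀ : ℝ → ℝ} {p e a b : ℝ → ℝ → ℝ}

/-- The energy decays along the characteristics. -/
theorem energy_le (h : IsLagrangianSolution ν n P₀ E₀ p e a b) (hν : 0 ≤ ν) (r : ℝ) {t : ℝ}
    (ht : 0 ≤ t) :
    Real.sqrt (1 + p r t ^ 2) + e r t ^ 2 / 2 ≤ Real.sqrt (1 + P₀ r ^ 2) + E₀ r ^ 2 / 2 := by
  have hd : ∀ t, HasDerivAt (fun t => Real.sqrt (1 + p r t ^ 2) + e r t ^ 2 / 2)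
      (-(ν * (p r t * velocity (p r t)))) t := by
    intro t
    have h1 := (hasDerivAt_gamma (p r t)).comp t (h.deriv_p r t)
    have h2 := ((h.deriv_e r t).pow 2).div_const 2
    refine (h1.add h2).congr_deriv ?_
    push_cast
    ring
  have := le_of_hasDerivAt_nonpos hd (fun t _ => by
    have h1 : p r t * velocity (p r t) = p r t ^ 2 / Real.sqrt (1 + p r t ^ 2) := by
      rw [velocity]; ring
    rw [h1, neg_nonpos]
    positivity) ht
  simpa only [h.init_p, h.init_e] using this

/-- By `√(1 + P₀²) ≤ 1 + P₀²/2` the initial energy is at most `1 + ε²/2`, and both `√(1 + p²) - 1`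
and `e²/2` are nonnegative. -/
theorem gamma_sub_one_le (h : IsLagrangianSolution ν n P₀ E₀ p e a b) (hν : 0 ≤ ν) {r ε : ℝ}
    (h0 : E₀ r ^ 2 + P₀ r ^ 2 ≤ ε ^ 2) {t : ℝ} (ht : 0 ≤ t) :
    Real.sqrt (1 + p r t ^ 2) - 1 ≤ ε ^ 2 / 2 ∧ e r t ^ 2 ≤ ε ^ 2 := by
  have h1 := h.energy_le hν r ht
  have h2 : Real.sqrt (1 + P₀ r ^ 2) ≤ 1 + P₀ r ^ 2 / 2 := by
    rw [Real.sqrt_le_left (by positivity)]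
    nlinarith [sq_nonneg (P₀ r ^ 2)]
  have h3 := one_le_gamma (p r t)
  constructor
  · linarith [sq_nonneg (e r t)]
  · linarith

/-- Lyapunov estimate for the linearized system at small amplitude. -/
theorem linearized_le (h : IsLagrangianSolution ν n P₀ E₀ p e a b) (hν : 0 < ν) {r ε : ℝ}
    (hε : 0 < ε) (hεν : 6 * ε * (1 + ν ^ 2) ≤ ν) (h0 : E₀ r ^ 2 + P₀ r ^ 2 ≤ ε ^ 2)
    {t : ℝ} (ht : 0 ≤ t) :
    a r t ^ 2 + b r t ^ 2 ≤ 2 * (deriv P₀ r ^ 2 + deriv E₀ r ^ 2) := by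
  have hε1 : ε ≤ 1 / 12 := by nlinarith [sq_nonneg (ν - 1)]
  -- The cross term `6ε ab` contributes `-6ε b²`, the damping in `b` missing from `a² + b²`.
  have hd : ∀ t, HasDerivAt (fun t => a r t ^ 2 + b r t ^ 2 + 6 * ε * (a r t * b r t))
      (2 * a r t * (-b r t - ν * a r t)
        + 2 * b r t * (1 / Real.sqrt (1 + p r t ^ 2) ^ 3 * a r t)
        + 6 * ε * ((-b r t - ν * a r t) * b r t
          + a r t * (1 / Real.sqrt (1 + p r t ^ 2) ^ 3 * a r t))) t := by
    intro t
    refine ((((h.deriv_a r t).pow 2).add ((h.deriv_b r t).pow 2)).add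
      (((h.deriv_a r t).mul (h.deriv_b r t)).const_mul (6 * ε))).congr_deriv ?_
    push_cast
    ring
  have key := le_of_hasDerivAt_nonpos hd (fun t ht => by
    obtain ⟨h1, -⟩ := h.gamma_sub_one_le hν.le h0 ht
    have h2 := one_sub_le_one_div_pow (one_le_gamma (p r t))
    have h3 := one_div_gamma_pow_le_one (p r t)
    generalize 1 / Real.sqrt (1 + p r t ^ 2) ^ 3 = m at *
    generalize a r t = x
    generalize b r t = y
    -- `1 - m ≤ 3ε²/2 ≤ ε`.
    have hm : 1 - m ≤ ε := by nlinarith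
    have e1 : 2 * (m - 1) * (x * y) ≤ ε * (x ^ 2 + y ^ 2) := by
      nlinarith [mul_nonneg (sub_nonneg.2 h3) (sq_nonneg (x + y)),
        mul_nonneg (sub_nonneg.2 hm) (add_nonneg (sq_nonneg x) (sq_nonneg y))]
    have e2 : -(6 * ε * ν * (x * y)) ≤ 3 * ε * (y ^ 2 + ν ^ 2 * x ^ 2) := by
      nlinarith [mul_nonneg hε.le (sq_nonneg (y + ν * x))]
    have e3 : 6 * ε * (m * x ^ 2) ≤ 6 * ε * x ^ 2 := by
      have := mul_le_mul_of_nonneg_right h3 (sq_nonneg x)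
      nlinarith
    have e4 : 6 * ε * (1 + ν ^ 2) * x ^ 2 ≤ ν * x ^ 2 := by gcongr
    have e5 : 0 ≤ ε * (ν ^ 2 * x ^ 2) := by positivity
    have e6 : ε * x ^ 2 ≤ ν * x ^ 2 := by
      have : 0 ≤ ε * x ^ 2 := by positivity
      nlinarith
    have e7 : 0 ≤ ε * y ^ 2 := by positivity
    -- In total the coefficient of `b²` is at most `ε - 6ε + 3ε = -2ε`, and that of `a²` at most
    -- `-2ν + 7ε + 3εν² ≤ 0`.
    nlinarith) ht
  simp only [h.init_a, h.init_b] at key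
  have f1 : ∀ x y : ℝ, |6 * ε * (x * y)| ≤ (x ^ 2 + y ^ 2) / 4 := by
    intro x y
    rw [abs_mul, abs_of_pos (by positivity : 0 < 6 * ε)]
    have h1 : |x * y| ≤ (x ^ 2 + y ^ 2) / 2 := by
      rw [abs_le]
      constructor <;> nlinarith [sq_nonneg (x + y), sq_nonneg (x - y)]
    have h2 : 6 * ε ≤ 1 / 2 := by linarith
    calc 6 * ε * |x * y| ≤ 1 / 2 * ((x ^ 2 + y ^ 2) / 2) := by gcongr
      _ = _ := by ring
  have f2 := (abs_le.1 (f1 (a r t) (b r t))).1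
  have f3 := (abs_le.1 (f1 (deriv P₀ r) (deriv E₀ r))).2
  -- The functional lies between `3/4` and `5/4` of `a² + b²`, and `5/3 ≤ 2`.
  nlinarith [sq_nonneg (deriv P₀ r), sq_nonneg (deriv E₀ r)]

end IsLagrangianSolution

/-! ### Back to Eulerian coordinates. -/

theorem coe_ne_zero_of_one_le {n : ℕ∞} (hn : 1 ≤ n) : (n : WithTop ℕ∞) ≠ 0 := by
  have : n ≠ 0 := (zero_lt_one.trans_le hn).ne'
  exact_mod_cast this

theorem hasDerivAt_slice {F : ℝ × ℝ → ℝ} {L : ℝ × ℝ →L[ℝ] ℝ} {x t : ℝ}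
    (hF : HasFDerivAt F L (x, t)) : HasDerivAt (fun y => F (y, t)) (L (1, 0)) x :=
  HasFDerivAt.comp_hasDerivAt (f := fun y : ℝ => (y, t)) x hF
    ((hasDerivAt_id x).prodMk (hasDerivAt_const x t))

/-- The derivative of a function of position and time along a moving point. -/
theorem hasDerivAt_along {f : ℝ → ℝ → ℝ} {x : ℝ → ℝ} {c t : ℝ}
    (hf : DifferentiableAt ℝ (fun q : ℝ × ℝ => f q.1 q.2) (x t, t)) (hx : HasDerivAt x c t) :
    HasDerivAt (fun s => f (x s) s)
      (deriv (fun s => f (x t) s) t + c * deriv (fun y => f y t) (x t)) t := by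
  have hF := hf.hasFDerivAt
  set L := fderiv ℝ (fun q : ℝ × ℝ => f q.1 q.2) (x t, t)
  have h1 : HasDerivAt (fun s => f (x t) s) (L (0, 1)) t :=
    HasFDerivAt.comp_hasDerivAt (f := fun s : ℝ => (x t, s)) t hF
      ((hasDerivAt_const t (x t)).prodMk (hasDerivAt_id t))
  have h2 : HasDerivAt (fun y => f y t) (L (1, 0)) (x t) :=
    hasDerivAt_slice hF
  have h3 : HasDerivAt (fun s => f (x s) s) (L (c, 1)) t :=
    HasFDerivAt.comp_hasDerivAt (f := fun s : ℝ => (x s, s)) t hF (hx.prodMk (hasDerivAt_id t))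
  refine h3.congr_deriv ?_
  rw [h1.deriv, h2.deriv, ← smul_eq_mul, ← map_smul, ← map_add]
  simp

/-- The inverse in the first variable of a time-dependent change of variables is as smooth as the
change of variables, up to the initial time. -/
theorem contDiffOn_inverse {X R : ℝ → ℝ → ℝ} {X' : ℝ → ℝ → ℝ} {n : ℕ∞} (hn : 1 ≤ n)
    (hX : ContDiff ℝ n fun q : ℝ × ℝ => X q.1 q.2)
    (hX' : ∀ r t, HasDerivAt (fun s => X s t) (X' r t) r) (hpos : ∀ r t, 0 ≤ t → 0 < X' r t)
    (hR : ∀ ρ t, 0 ≤ t → X (R ρ t) t = ρ) :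
    ContDiffOn ℝ n (fun q : ℝ × ℝ => R q.1 q.2) (univ ×ˢ Ici 0) := by
  have hn0 : (n : WithTop ℕ∞) ≠ 0 := coe_ne_zero_of_one_le hn
  have hinj : ∀ t, 0 ≤ t → Function.Injective fun s => X s t := fun t ht =>
    (strictMono_of_deriv_pos fun r => by rw [(hX' r t).deriv]; exact hpos r t ht).injective
  rintro ⟨ρ, t⟩ ⟨-, ht⟩
  have ht : 0 ≤ t := ht
  let Ψ : ℝ × ℝ → ℝ × ℝ := fun q => (X q.1 q.2, q.2)
  have hΨ : ContDiff ℝ n Ψ := hX.prodMk contDiff_snd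
  set y : ℝ × ℝ := (R ρ t, t) with hy
  set α := X' (R ρ t) t with hα
  have hα0 : α ≠ 0 := (hpos _ _ ht).ne'
  set L := fderiv ℝ (fun q : ℝ × ℝ => X q.1 q.2) y
  have hL : HasFDerivAt (fun q : ℝ × ℝ => X q.1 q.2) L y :=
    (hX.differentiable hn0 y).hasFDerivAt
  have hL1 : L (1, 0) = α := by
    have h2 : HasDerivAt (fun s => X s t) (L (1, 0)) (R ρ t) :=
      hasDerivAt_slice hL
    exact h2.unique (hX' _ _)
  obtain ⟨β, hLapp⟩ : ∃ β, ∀ h k, L (h, k) = α * h + β * k := by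
    refine ⟨L (0, 1), fun h k => ?_⟩
    have : ((h, k) : ℝ × ℝ) = h • (1, 0) + k • (0, 1) := by simp
    rw [this, map_add, map_smul, map_smul, hL1, smul_eq_mul, smul_eq_mul]
    ring
  -- The derivative of `(r, t) ↦ (X, t)` is triangular with diagonal `α, 1`. Since `X` is defined
  -- for all real times, the inverse function theorem applies at `t = 0` too.
  let M : (ℝ × ℝ) ≃L[ℝ] ℝ × ℝ := ContinuousLinearEquiv.equivOfInverse
    (L.prod (ContinuousLinearMap.snd ℝ ℝ ℝ))
    ((α⁻¹ • (ContinuousLinearMap.fst ℝ ℝ ℝ - β • ContinuousLinearMap.snd ℝ ℝ ℝ)).prod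
      (ContinuousLinearMap.snd ℝ ℝ ℝ))
    (by
      rintro ⟨h, k⟩
      simp [hLapp]
      field_simp)
    (by
      rintro ⟨h, k⟩
      simp [hLapp]
      field_simp
      ring)
  have hM : HasFDerivAt Ψ (M : ℝ × ℝ →L[ℝ] ℝ × ℝ) y := hL.prodMk hasFDerivAt_snd
  have hΨy : Ψ y = (ρ, t) := by simp [Ψ, y, hR ρ t ht]
  have hg := hΨ.contDiffAt.to_localInverse hM hn0
  have hright := (hΨ.contDiffAt.hasStrictFDerivAt' hM hn0).eventually_right_inverse
  rw [hΨy] at hg hright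
  set g := hΨ.contDiffAt.localInverse hM hn0
  have hfst : ContDiffWithinAt ℝ n (fun q => (g q).1) (univ ×ˢ Ici 0) (ρ, t) :=
    (contDiffAt_fst.comp (ρ, t) hg).contDiffWithinAt
  -- The local inverse agrees with `R` only at nonnegative times, where injectivity is known; this
  -- suffices for smoothness within the half-plane.
  have hev : ∀ q : ℝ × ℝ, 0 ≤ q.2 → Ψ (g q) = q → R q.1 q.2 = (g q).1 := by
    intro q hq0 hq
    have h2 : (g q).2 = q.2 := (Prod.ext_iff.1 hq).2
    have h1 : X (g q).1 (g q).2 = q.1 := (Prod.ext_iff.1 hq).1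
    rw [h2] at h1
    exact hinj q.2 hq0 ((hR q.1 q.2 hq0).trans h1.symm)
  refine hfst.congr_of_eventuallyEq ?_ (hev (ρ, t) ht hright.self_of_nhds)
  filter_upwards [nhdsWithin_le_nhds hright, self_mem_nhdsWithin] with q hq hq0
  exact hev q hq0.2 hq

namespace IsLagrangianSolution

variable {ν : ℝ} {n : ℕ∞} {P₀ E₀ : ℝ → ℝ} {p e a b : ℝ → ℝ → ℝ}

/-- Along the characteristics, `x - E` is constant. -/
theorem hasDerivAt_position (h : IsLagrangianSolution ν n P₀ E₀ p e a b) (r t : ℝ) :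
    HasDerivAt (fun t => r + e r t - E₀ r) (velocity (p r t)) t :=
  ((h.deriv_e r t).const_add r).sub_const _

theorem hasDerivAt_position_param (h : IsLagrangianSolution ν n P₀ E₀ p e a b)
    (hE : Differentiable ℝ E₀) (r t : ℝ) :
    HasDerivAt (fun s => s + e s t - E₀ s) (1 + b r t - deriv E₀ r) r :=
  ((hasDerivAt_id r).add (h.param_e r t)).sub (hE r).hasDerivAt

/-- Characteristics move by at most `2ε`, because `|e|` and `|E₀|` are at most `ε`; the intermediate
value theorem does the rest. -/
theorem exists_position_eq (h : IsLagrangianSolution ν n P₀ E₀ p e a b) (hν : 0 ≤ ν)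
    (hE : Continuous E₀) {ε : ℝ} (hε : 0 ≤ ε) (h0 : ∀ r, E₀ r ^ 2 + P₀ r ^ 2 ≤ ε ^ 2)
    {t : ℝ} (ht : 0 ≤ t) (ρ : ℝ) : ∃ r, r + e r t - E₀ r = ρ := by
  have hc : Continuous fun r => r + e r t - E₀ r := by
    have h1 : Continuous fun r => e r t := by
      have h2 := h.contDiff_e.continuous
      exact h2.comp (continuous_id.prodMk continuous_const)
    fun_prop
  have he : ∀ r, |e r t| ≤ ε := fun r =>
    abs_le_of_sq_le_sq (h.gamma_sub_one_le hν (h0 r) ht).2 hε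
  have hE0 : ∀ r, |E₀ r| ≤ ε := fun r =>
    abs_le_of_sq_le_sq (by linarith [h0 r, sq_nonneg (P₀ r)]) hε
  have h1 : ρ - 2 * ε + e (ρ - 2 * ε) t - E₀ (ρ - 2 * ε) ≤ ρ := by
    linarith [(abs_le.1 (he (ρ - 2 * ε))).2, (abs_le.1 (hE0 (ρ - 2 * ε))).1]
  have h2 : ρ ≤ ρ + 2 * ε + e (ρ + 2 * ε) t - E₀ (ρ + 2 * ε) := by
    linarith [(abs_le.1 (he (ρ + 2 * ε))).1, (abs_le.1 (hE0 (ρ + 2 * ε))).2]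
  exact mem_range_of_exists_le_of_exists_ge hc ⟨_, h1⟩ ⟨_, h2⟩

/-- `|b| ≤ 2ε` and `|E₀'| ≤ ε`, while `3ε ≤ 1/4`. -/
theorem position_deriv_pos (h : IsLagrangianSolution ν n P₀ E₀ p e a b) (hν : 0 < ν) {r ε : ℝ}
    (hε : 0 < ε) (hεν : 6 * ε * (1 + ν ^ 2) ≤ ν)
    (h0 : E₀ r ^ 2 + P₀ r ^ 2 + deriv E₀ r ^ 2 + deriv P₀ r ^ 2 ≤ ε ^ 2)
    {t : ℝ} (ht : 0 ≤ t) : 0 < 1 + b r t - deriv E₀ r := by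
  have hε1 : ε ≤ 1 / 12 := by nlinarith [sq_nonneg (ν - 1)]
  have h1 := h.linearized_le hν hε hεν
    (by linarith [sq_nonneg (deriv E₀ r), sq_nonneg (deriv P₀ r)]) ht
  have h2 : |b r t| ≤ 2 * ε := abs_le_of_sq_le_sq (by
    nlinarith [sq_nonneg (a r t), sq_nonneg (E₀ r), sq_nonneg (P₀ r)]) (by linarith)
  have h3 : |deriv E₀ r| ≤ ε := abs_le_of_sq_le_sq (by
    nlinarith [sq_nonneg (deriv P₀ r), sq_nonneg (E₀ r), sq_nonneg (P₀ r)]) hε.le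
  linarith [(abs_le.1 h2).1, (abs_le.1 h3).2]

/-- The Lagrangian solution in Eulerian coordinates solves the Cauchy problem, as long as the
characteristics form a change of variables with inverse `R`. -/
theorem isClassicalSolution (h : IsLagrangianSolution ν n P₀ E₀ p e a b) (hn : 1 ≤ n)
    (hE : ContDiff ℝ n E₀) {R : ℝ → ℝ → ℝ}
    (hpos : ∀ r t, 0 ≤ t → 0 < 1 + b r t - deriv E₀ r)
    (hR : ∀ ρ t, 0 ≤ t → R ρ t + e (R ρ t) t - E₀ (R ρ t) = ρ)
    (hRX : ∀ r t, 0 ≤ t → R (r + e r t - E₀ r) t = r) :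
    IsClassicalSolution ν n (Ici 0) P₀ E₀ (fun ρ θ => p (R ρ θ) θ) (fun ρ θ => e (R ρ θ) θ) := by
  have hn0 : (n : WithTop ℕ∞) ≠ 0 := coe_ne_zero_of_one_le hn
  have hRC : ContDiffOn ℝ n (fun q : ℝ × ℝ => R q.1 q.2) (univ ×ˢ Ici 0) :=
    contDiffOn_inverse (X := fun r t => r + e r t - E₀ r) hn
      ((contDiff_fst.add h.contDiff_e).sub (hE.comp contDiff_fst))
      (h.hasDerivAt_position_param (hE.differentiable hn0)) hpos hR
  have hPC : ContDiffOn ℝ n (fun q : ℝ × ℝ => p (R q.1 q.2) q.2) (univ ×ˢ Ici 0) :=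
    h.contDiff_p.comp_contDiffOn (hRC.prodMk contDiffOn_snd)
  have hEC : ContDiffOn ℝ n (fun q : ℝ × ℝ => e (R q.1 q.2) q.2) (univ ×ˢ Ici 0) :=
    h.contDiff_e.comp_contDiffOn (hRC.prodMk contDiffOn_snd)
  have hnhds : ∀ ρ θ : ℝ, 0 < θ → univ ×ˢ Ici 0 ∈ 𝓝 (ρ, θ) := fun ρ θ hθ =>
    prod_mem_nhds univ_mem (Ici_mem_nhds hθ)
  have hR0 : ∀ ρ, R ρ 0 = ρ := fun ρ => by
    have := hRX ρ 0 le_rfl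
    rwa [h.init_e, add_sub_cancel_right] at this
  have transport : ∀ {f : ℝ → ℝ → ℝ} {f' : ℝ → ℝ → ℝ},
      ContDiffOn ℝ n (fun q : ℝ × ℝ => f (R q.1 q.2) q.2) (univ ×ˢ Ici 0) →
      (∀ r t, HasDerivAt (f r) (f' r t) t) → ∀ ρ θ : ℝ, 0 < θ →
      deriv (fun t => f (R ρ t) t) θ
        + velocity (p (R ρ θ) θ) * deriv (fun y => f (R y θ) θ) ρ = f' (R ρ θ) θ := by
    intro f f' hf hf' ρ θ hθ
    have hd : DifferentiableAt ℝ (fun q : ℝ × ℝ => f (R q.1 q.2) q.2) (ρ, θ) :=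
      (hf.contDiffAt (hnhds ρ θ hθ)).differentiableAt hn0
    have hX := hR ρ θ hθ.le
    have h1 := hasDerivAt_along (f := fun ρ θ => f (R ρ θ) θ)
      (x := fun t => R ρ θ + e (R ρ θ) t - E₀ (R ρ θ)) (t := θ)
      (by simpa only [hX] using hd) (h.hasDerivAt_position (R ρ θ) θ)
    simp only [hX] at h1
    -- Along a characteristic `R` returns its starting point, so the composed function is `f r` near
    -- `θ`.
    refine h1.unique ((hf' (R ρ θ) θ).congr_of_eventuallyEq ?_)
    filter_upwards [Ioi_mem_nhds hθ] with t ht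
    rw [hRX _ t (le_of_lt ht)]
  refine ⟨hPC, hEC, fun ρ θ _ hθ => ?_, fun ρ θ _ hθ => ?_, fun ρ => ?_, fun ρ => ?_⟩
  · rw [transport hPC h.deriv_p ρ θ hθ]
    ring
  · rw [transport hEC h.deriv_e ρ θ hθ]
    ring
  · rw [hR0, h.init_p]
  · rw [hR0, h.init_e]

end IsLagrangianSolution

/-! ### Uniqueness. -/

/-- A `C¹` function on a time strip has bounded space derivatives along a continuous curve. -/
theorem exists_deriv_bound_along {f : ℝ → ℝ → ℝ} {T τ : ℝ} {x : ℝ → ℝ}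
    (hf : ContDiffOn ℝ 1 (fun q : ℝ × ℝ => f q.1 q.2) (univ ×ˢ Ico 0 T))
    (hx : Continuous x) (hτ : τ < T) :
    ∃ M, ∀ t ∈ Ioc 0 τ, |deriv (fun y => f y t) (x t)| ≤ M := by
  set S : Set (ℝ × ℝ) := univ ×ˢ Ico 0 T
  have hc : ContinuousOn
      (fun t => fderivWithin ℝ (fun q : ℝ × ℝ => f q.1 q.2) S (x t, t) (1, 0)) (Icc 0 τ) := by
    have h1 := hf.continuousOn_fderivWithin (uniqueDiffOn_univ.prod (uniqueDiffOn_Ico 0 T)) le_rfl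
    have h2 : ContinuousOn (fun t => fderivWithin ℝ (fun q : ℝ × ℝ => f q.1 q.2) S (x t, t))
        (Icc 0 τ) := h1.comp (f := fun t => (x t, t)) (by fun_prop)
          fun t ht => ⟨trivial, ht.1, ht.2.trans_lt hτ⟩
    exact h2.clm_apply continuousOn_const
  obtain ⟨M, hM⟩ := isCompact_Icc.exists_bound_of_continuousOn hc
  refine ⟨M, fun t ht => ?_⟩
  have hnhds : S ∈ 𝓝 (x t, t) := prod_mem_nhds univ_mem (Ico_mem_nhds ht.1 (ht.2.trans_lt hτ))
  have hd : DifferentiableAt ℝ (fun q : ℝ × ℝ => f q.1 q.2) (x t, t) :=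
    (hf.contDiffAt hnhds).differentiableAt one_ne_zero
  have h2 : HasDerivAt (fun y => f y t)
      (fderiv ℝ (fun q : ℝ × ℝ => f q.1 q.2) (x t, t) (1, 0)) (x t) :=
    hasDerivAt_slice hd.hasFDerivAt
  rw [h2.deriv, ← fderivWithin_of_mem_nhds hnhds, ← Real.norm_eq_abs]
  exact hM t ⟨ht.1.le, ht.2⟩

/-- Gronwall uniqueness when the differential inequality is only known for positive times. -/
theorem eq_zero_of_norm_deriv_le {F : Type*} [NormedAddCommGroup F] [NormedSpace ℝ F]
    {f f' : ℝ → F} {K τ : ℝ} (hτ : 0 < τ) (hf : ContinuousOn f (Icc 0 τ)) (h0 : f 0 = 0)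
    (hf' : ∀ t ∈ Ioc 0 τ, HasDerivAt f (f' t) t) (hb : ∀ t ∈ Ioc 0 τ, ‖f' t‖ ≤ K * ‖f t‖) :
    f τ = 0 := by
  have h1 : ∀ s ∈ Ioc 0 τ, ‖f τ‖ ≤ ‖f s‖ * Real.exp (K * (τ - s)) := by
    intro s hs
    have := norm_le_gronwallBound_of_norm_deriv_right_le (f := f) (f' := f') (δ := ‖f s‖) (K := K)
      (ε := 0) (a := s) (b := τ) (hf.mono (Icc_subset_Icc_left hs.1.le))
      (fun t ht => (hf' t ⟨hs.1.trans_le ht.1, ht.2.le⟩).hasDerivWithinAt) le_rfl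
      (fun t ht => by simpa using hb t ⟨hs.1.trans_le ht.1, ht.2.le⟩) τ ⟨hs.2, le_rfl⟩
    rwa [gronwallBound_ε0] at this
  -- Gronwall starts at `s > 0`; continuity at `0` then lets `s → 0`.
  have h2 : Tendsto (fun s => ‖f s‖ * Real.exp (K * (τ - s))) (𝓝[Ioc 0 τ] 0) (𝓝 0) := by
    have hc : ContinuousOn (fun s => ‖f s‖ * Real.exp (K * (τ - s))) (Icc 0 τ) :=
      hf.norm.mul (by fun_prop)
    have := (hc 0 ⟨le_rfl, hτ.le⟩).mono Ioc_subset_Icc_self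
    simpa [ContinuousWithinAt, h0] using this
  have hne : (𝓝[Ioc 0 τ] (0 : ℝ)).NeBot := by
    rw [← mem_closure_iff_nhdsWithin_neBot, closure_Ioc hτ.ne]
    exact ⟨le_rfl, hτ.le⟩
  have h3 : ‖f τ‖ ≤ 0 := ge_of_tendsto h2 (eventually_mem_nhdsWithin.mono h1)
  exact norm_le_zero_iff.1 h3

/-- Every `C¹` solution coincides with the Lagrangian one along its characteristics. -/
theorem IsLagrangianSolution.eq_of_isClassicalSolution {ν : ℝ} {n : ℕ∞} {P₀ E₀ : ℝ → ℝ}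
    {p e a b : ℝ → ℝ → ℝ} (h : IsLagrangianSolution ν n P₀ E₀ p e a b) (hν : 0 ≤ ν) {T : ℝ}
    {P E : ℝ → ℝ → ℝ} (hs : IsClassicalSolution ν 1 (Ico 0 T) P₀ E₀ P E) (r : ℝ) {τ : ℝ}
    (hτ : τ ∈ Ico 0 T) :
    P (r + e r τ - E₀ r) τ = p r τ ∧ E (r + e r τ - E₀ r) τ = e r τ := by
  rcases hτ.1.eq_or_lt with rfl | hτ0
  · simp [h.init_e, h.init_p, hs.init_P, hs.init_E]
  set x : ℝ → ℝ := fun t => r + e r t - E₀ r with hx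
  have hxd : ∀ t, HasDerivAt x (velocity (p r t)) t := h.hasDerivAt_position r
  have hxc : Continuous x := continuous_iff_continuousAt.2 fun t => (hxd t).continuousAt
  have hpc : Continuous (p r) :=
    continuous_iff_continuousAt.2 fun t => (h.deriv_p r t).continuousAt
  have hec : Continuous (e r) :=
    continuous_iff_continuousAt.2 fun t => (h.deriv_e r t).continuousAt
  have hPC : ContDiffOn ℝ 1 (fun q : ℝ × ℝ => P q.1 q.2) (univ ×ˢ Ico 0 T) := hs.contDiffOn_P
  have hEC : ContDiffOn ℝ 1 (fun q : ℝ × ℝ => E q.1 q.2) (univ ×ˢ Ico 0 T) := hs.contDiffOn_E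
  obtain ⟨M₁, hM₁⟩ := exists_deriv_bound_along hPC hxc hτ.2
  obtain ⟨M₂, hM₂⟩ := exists_deriv_bound_along hEC hxc hτ.2
  have hmaps : MapsTo (fun t => (x t, t)) (Icc 0 τ) (univ ×ˢ Ico 0 T) :=
    fun t ht => ⟨trivial, ht.1, ht.2.trans_lt hτ.2⟩
  have hcont : ContinuousOn (fun t => (P (x t) t - p r t, E (x t) t - e r t)) (Icc 0 τ) :=
    ((hPC.continuousOn.comp (by fun_prop) hmaps).sub hpc.continuousOn).prodMk
      ((hEC.continuousOn.comp (by fun_prop) hmaps).sub hec.continuousOn)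
  have hdiff : ∀ {f : ℝ → ℝ → ℝ},
      ContDiffOn ℝ 1 (fun q : ℝ × ℝ => f q.1 q.2) (univ ×ˢ Ico 0 T) → ∀ t ∈ Ioc 0 τ,
      DifferentiableAt ℝ (fun q : ℝ × ℝ => f q.1 q.2) (x t, t) := fun hf t ht =>
    (hf.contDiffAt (prod_mem_nhds univ_mem
      (Ico_mem_nhds ht.1 (ht.2.trans_lt hτ.2)))).differentiableAt one_ne_zero
  have hzero := eq_zero_of_norm_deriv_le (K := 1 + ν + |M₁| + |M₂|) hτ0 hcont
    (by simp [hx, h.init_p, h.init_e, hs.init_P, hs.init_E])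
    (fun t ht => ((hasDerivAt_along (hdiff hPC t ht) (hxd t)).sub (h.deriv_p r t)).prodMk
      ((hasDerivAt_along (hdiff hEC t ht) (hxd t)).sub (h.deriv_e r t)))
    (fun t ht => by
      have hP := hs.eq_P (x t) t ⟨ht.1.le, ht.2.trans_lt hτ.2⟩ ht.1
      have hE := hs.eq_E (x t) t ⟨ht.1.le, ht.2.trans_lt hτ.2⟩ ht.1
      have b1 := (hM₁ t ht).trans (le_abs_self M₁)
      have b2 := (hM₂ t ht).trans (le_abs_self M₂)
      have hV := abs_velocity_sub_le (p r t) (P (x t) t)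
      rw [abs_sub_comm (p r t)] at hV
      rw [Prod.norm_def, Prod.norm_def]
      simp only [Real.norm_eq_abs]
      set m := max |P (x t) t - p r t| |E (x t) t - e r t|
      have m1 : |P (x t) t - p r t| ≤ m := le_max_left _ _
      have m2 : |E (x t) t - e r t| ≤ m := le_max_right _ _
      have m0 : 0 ≤ m := (abs_nonneg _).trans m1
      set Pρ := deriv (fun y => P y t) (x t)
      set Eρ := deriv (fun y => E y t) (x t)
      have hVm := hV.trans m1
      -- The curve moves with velocity `V(p)` but the equation transports with `V(P)`; the mismatch
      -- is Lipschitz in `P - p`, times a bounded space derivative.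
      have c1 : |(velocity (p r t) - velocity (P (x t) t)) * Pρ| ≤ m * |M₁| := by
        rw [abs_mul]; gcongr
      have c2 : |(velocity (p r t) - velocity (P (x t) t)) * Eρ| ≤ m * |M₂| := by
        rw [abs_mul]; gcongr
      have c3 : |ν * (P (x t) t - p r t)| ≤ ν * m := by
        rw [abs_mul, abs_of_nonneg hν]; gcongr
      have d1 : 0 ≤ m * |M₁| := by positivity
      have d2 : 0 ≤ m * |M₂| := by positivity
      have d3 : 0 ≤ ν * m := by positivity
      rw [abs_le] at c1 c2 c3 m2 hVm
      apply max_le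
      · rw [abs_le]
        constructor <;> nlinarith
      · rw [abs_le]
        constructor <;> nlinarith)
  rw [Prod.mk_eq_zero] at hzero
  exact ⟨sub_eq_zero.1 hzero.1, sub_eq_zero.1 hzero.2⟩

end ColdPlasma


/-! ### Choice of `ε` and conclusion. -/

theorem theorem2p5 (ν : ℝ) (hν : 0 < ν) :
    ∃ ε : ℝ, 0 < ε ∧
      ∀ (n : ℕ∞), 2 ≤ n →
      ∀ (P₀ E₀ : ℝ → ℝ), ContDiff ℝ n P₀ → ContDiff ℝ n E₀ →
        (∀ ρ : ℝ, E₀ ρ ^ 2 + P₀ ρ ^ 2 + deriv E₀ ρ ^ 2 + deriv P₀ ρ ^ 2 ≤ ε ^ 2) →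
        ∃ P E : ℝ → ℝ → ℝ,
          ColdPlasma.IsClassicalSolution ν n (Set.Ici 0) P₀ E₀ P E ∧
          ∀ (T : ℝ) (P' E' : ℝ → ℝ → ℝ),
            ColdPlasma.IsClassicalSolution ν 1 (Set.Ico 0 T) P₀ E₀ P' E' →
            ∀ ρ : ℝ, ∀ θ ∈ Set.Ico 0 T, P' ρ θ = P ρ θ ∧ E' ρ θ = E ρ θ := by
  -- The largest `ε` allowed by the Lyapunov condition `6ε(1 + ν²) ≤ ν`.
  refine ⟨ν / (6 * (1 + ν ^ 2)), by positivity, fun n hn P₀ E₀ hP₀ hE₀ hsmall => ?_⟩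
  have hεν : 6 * (ν / (6 * (1 + ν ^ 2))) * (1 + ν ^ 2) ≤ ν := by
    apply le_of_eq
    field_simp
  have hε : 0 < ν / (6 * (1 + ν ^ 2)) := by positivity
  generalize ν / (6 * (1 + ν ^ 2)) = ε at *
  have hn1 : 1 ≤ n := le_trans (by norm_num) hn
  have hdiff : Differentiable ℝ E₀ := hE₀.differentiable (ColdPlasma.coe_ne_zero_of_one_le hn1)
  obtain ⟨p, e, a, b, h⟩ := ColdPlasma.exists_lagrangianSolution hν.le hn1 hP₀ hE₀
  have hpos : ∀ r t, 0 ≤ t → 0 < 1 + b r t - deriv E₀ r := fun r t ht =>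
    h.position_deriv_pos hν hε hεν (hsmall r) ht
  -- The condition `0 ≤ t` sits under the existential so that `choose` gives a function of `ρ` and
  -- `t` alone, with junk values for `t < 0`.
  have hsurj : ∀ ρ t, ∃ r, 0 ≤ t → r + e r t - E₀ r = ρ := by
    intro ρ t
    by_cases ht : 0 ≤ t
    · obtain ⟨r, hr⟩ := h.exists_position_eq hν.le hE₀.continuous hε.le
        (fun r => by linarith [hsmall r, sq_nonneg (deriv E₀ r), sq_nonneg (deriv P₀ r)]) ht ρ
      exact ⟨r, fun _ => hr⟩
    · exact ⟨0, fun h => absurd h ht⟩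
  choose R hR using hsurj
  have hRX : ∀ r t, 0 ≤ t → R (r + e r t - E₀ r) t = r := by
    intro r t ht
    have hinj : Function.Injective fun s => s + e s t - E₀ s :=
      (strictMono_of_deriv_pos fun s => by
        rw [(h.hasDerivAt_position_param hdiff s t).deriv]
        exact hpos s t ht).injective
    exact hinj (hR _ t ht)
  refine ⟨_, _, h.isClassicalSolution hn1 hE₀ hpos hR hRX, fun T P' E' hs ρ θ hθ => ?_⟩
  have := h.eq_of_isClassicalSolution hν.le hs (R ρ θ) hθ
  rwa [hR ρ θ hθ.1] at this
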